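/- For every integer $k\ge 3$ and every real $\varepsilon>0$ there exists $\beta=\beta(k,\varepsilon)>0$ such that the following holds for every Hilbert space $\mathcal H$ over $\mathbb K=\mathbb R$ or $\mathbb K=\mathbb C$. Let $T:\mathcal H^k\to\mathbb K$ be a continuous symmetric $k$-linear form with $\|T\|=1$, where $$\|T\|=\sup\{|T(w_1,\dots,w_k)| : \|w_1\|,\dots,\|w_k\|\le 1\},$$ and let $x_1,\dots,x_k\in\mathcal H$ be norm-one vectors with $|T(x_1,\dots,x_k)|>1-\beta$. Then there is a linear subspace $V\subseteq\operatorname{span}\{x_1,\dots,x_k\}$, with $\dim V\le 2$ if $\mathbb K=\mathbb R$ and $\dim V=1$ if $\mathbb K=\mathbb C$, such that $\operatorname{dist}(x_j,V)\le\varepsilon$ for every $j=1,\dots,k$. -/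

import Mathlib

universe u


/-- A continuous `k`-linear form is symmetric if its value does not change under
any permutation of its arguments. -/
def IsSymmForm {𝕜 H : Type*} [RCLike 𝕜] [NormedAddCommGroup H] [InnerProductSpace 𝕜 H] {k : ℕ}
    (T : ContinuousMultilinearMap 𝕜 (fun _ : Fin k => H) 𝕜) : Prop :=
  ∀ (σ : Equiv.Perm (Fin k)) (w : Fin k → H), T (fun i => w (σ i)) = T w

/-!
Freezing all but three of the arguments and taking a suitable real part gives a real symmetric
trilinear form `F` of norm at most one with `F z x y ≈ 1`, for any three `x`, `y`, `z` of the
vectors. The bilinear form `F z` then almost attains its norm at the direction `u` of `x + y` and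
minus its norm at the direction `v` of `x - y`: `F z u u ≈ 1` and `F z v v ≈ -1`.

A functional of norm `M` on a Hilbert space taking the value `M` at a unit vector `u` is
`M ⟪u, ·⟫`, and this is stable under perturbation. If `F z u u = 1`, this gives `F z u = ⟪u, ·⟫` and
`F u u = ⟪z, ·⟫`, so `F (u + z) (u + z)` takes the value `2 + 2 ⟪u, z⟫ = ‖u + z‖²` at `u`, hence
equals `‖u + z‖² ⟪u, ·⟫`; evaluating at `z` gives `F z z z = 2 ⟪u, z⟫² - 1`. Likewise
`-F z z z = 2 ⟪v, z⟫² - 1`. Adding up the approximate versions, `⟪u, z⟫² + ⟪v, z⟫² ≈ 1`, so `z` is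
close to the span of the orthogonal vectors `u` and `v`, which lies in the span of `x` and `y`.

In the complex case `F z (i u) (i u) = -F z u u`, so `v` may be replaced by `i u`, and `u` is
close to the complex line of `z`. The same holds for `x - y`, hence for `x`.
-/

-- Mathlib's own setting, needed for instances on `E →L[ℝ] E →L[ℝ] E →L[ℝ] ℝ`.
set_option maxSynthPendingDepth 3

open Function (update update_apply update_self update_of_ne update_comm update_eq_self)
open scoped InnerProductSpace

section Distance

theorem norm_mkQ_eq_infDist {R E : Type*} [Ring R] [SeminormedAddCommGroup E] [Module R E]
    (V : Submodule R E) (x : E) : ‖V.mkQ x‖ = Metric.infDist x (V : Set E) :=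
  QuotientAddGroup.norm_mk (S := V.toAddSubgroup) x

theorem infDist_submodule_add_le {R E : Type*} [Ring R] [SeminormedAddCommGroup E] [Module R E]
    (V : Submodule R E) (x y : E) : Metric.infDist (x + y) (V : Set E)
      ≤ Metric.infDist x (V : Set E) + Metric.infDist y (V : Set E) := by
  simp only [← norm_mkQ_eq_infDist, map_add]
  exact norm_add_le _ _

theorem infDist_submodule_smul {𝕜 E : Type*} [NormedField 𝕜] [SeminormedAddCommGroup E]
    [NormedSpace 𝕜 E] (V : Submodule 𝕜 E) (c : 𝕜) (x : E) :
    Metric.infDist (c • x) (V : Set E) = ‖c‖ * Metric.infDist x (V : Set E) := by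
  simp only [← norm_mkQ_eq_infDist, map_smul, norm_smul]

theorem sq_infDist_span_range_le_of_orthonormal {𝕜 E ι : Type*} [RCLike 𝕜]
    [SeminormedAddCommGroup E] [InnerProductSpace 𝕜 E] [Fintype ι] {e : ι → E}
    (he : Orthonormal 𝕜 e) (x : E) :
    Metric.infDist x (Submodule.span 𝕜 (Set.range e) : Set E) ^ 2
      ≤ ‖x‖ ^ 2 - ∑ i, ‖inner 𝕜 (e i) x‖ ^ 2 := by
  set p := ∑ i, inner 𝕜 (e i) x • e i with hp
  have p_mem : p ∈ Submodule.span 𝕜 (Set.range e) :=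
    Submodule.sum_smul_mem _ _ fun i _ => Submodule.subset_span (Set.mem_range_self i)
  have inner_e (i : ι) : inner 𝕜 (e i) p = inner 𝕜 (e i) x := he.inner_right_fintype _ i
  have inner_p : inner 𝕜 p (x - p) = 0 := by
    rw [hp, sum_inner]
    simp only [inner_smul_left, inner_sub_right, ← hp, inner_e, sub_self, Finset.sum_const_zero]
  have norm_p : ‖p‖ ^ 2 = ∑ i, ‖inner 𝕜 (e i) x‖ ^ 2 := by
    rw [norm_sq_eq_re_inner (𝕜 := 𝕜), hp, he.inner_sum]
    simp only [RCLike.conj_mul, map_sum]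
    norm_cast
  have pythagoras : ‖x‖ ^ 2 = ‖p‖ ^ 2 + ‖x - p‖ ^ 2 := by
    simpa [sq] using norm_add_sq_eq_norm_sq_add_norm_sq_of_inner_eq_zero p (x - p) inner_p
  calc
    _ ≤ ‖x - p‖ ^ 2 := by
      gcongr
      exacts [Metric.infDist_nonneg, dist_eq_norm x p ▸ Metric.infDist_le_dist_of_mem p_mem]
    _ = _ := by linarith

end Distance

section Duality

variable {E : Type*} [SeminormedAddCommGroup E] [InnerProductSpace ℝ E]

theorem sq_apply_sub_inner_le {f : StrongDual ℝ E} {M : ℝ} (hf : ‖f‖ ≤ M) {u : E} (hu : ‖u‖ = 1)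
    (y : E) : (f y - M * ⟪u, y⟫_ℝ) ^ 2 ≤ 2 * M * (M - f u) * ‖y‖ ^ 2 := by
  have hM : 0 ≤ M := (norm_nonneg f).trans hf
  have quadratic_nonneg (t : ℝ) :
      0 ≤ M * ‖y‖ ^ 2 / 2 * (t * t) + (M * ⟪u, y⟫_ℝ - f y) * t + (M - f u) := by
    have norm_le : ‖u + t • y‖ ≤ 1 + t * ⟪u, y⟫_ℝ + t ^ 2 * ‖y‖ ^ 2 / 2 := by
      have norm_sq : ‖u + t • y‖ ^ 2 = 1 + 2 * (t * ⟪u, y⟫_ℝ) + t ^ 2 * ‖y‖ ^ 2 := by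
        rw [norm_add_sq_real, inner_smul_right, norm_smul, hu, mul_pow, Real.norm_eq_abs, sq_abs,
          one_pow]
      linarith [sq_nonneg (‖u + t • y‖ - 1)]
    have := calc
      f u + t * f y = f (u + t • y) := by simp
      _ ≤ ‖f‖ * ‖u + t • y‖ := (le_abs_self _).trans (f.le_opNorm _)
      _ ≤ M * (1 + t * ⟪u, y⟫_ℝ + t ^ 2 * ‖y‖ ^ 2 / 2) := by gcongr
    linarith
  have := discrim_le_zero quadratic_nonneg
  rw [discrim] at this
  linarith

theorem norm_add_sq_sub_le_apply_add_add {B : E →L[ℝ] E →L[ℝ] ℝ} (hB : ‖B‖ ≤ 1)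
    (hsymm : ∀ a b, B a b = B b a) {x y : E} (hx : ‖x‖ = 1) (hy : ‖y‖ = 1) {τ : ℝ}
    (hτ : 0 ≤ τ) (hτ1 : τ ≤ 1) (h : 1 - τ ^ 2 / 2 ≤ B x y) :
    ‖x + y‖ ^ 2 - 3 * τ ≤ B (x + y) (x + y) := by
  have inner_sub_le {a b : E} (ha : ‖a‖ = 1) (hb : ‖b‖ = 1) (hab : 1 - τ ^ 2 / 2 ≤ B a b) :
      ⟪a, b⟫_ℝ - τ ≤ B a a := by
    have hsq := sq_apply_sub_inner_le ((B.unit_le_opNorm a ha.le).trans hB) hb a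
    rw [ha, real_inner_comm] at hsq
    have := abs_le_of_sq_le_sq (a := B a a - ⟪a, b⟫_ℝ) (b := τ) (by linarith) hτ
    linarith [neg_abs_le (B a a - ⟪a, b⟫_ℝ)]
  have hxx := inner_sub_le hx hy h
  have hyy := inner_sub_le hy hx (hsymm x y ▸ h)
  rw [real_inner_comm] at hyy
  have expand : B (x + y) (x + y) = B x x + 2 * B x y + B y y := by
    simp only [map_add, add_apply, hsymm y x]
    ring
  rw [expand, norm_add_sq_real, hx, hy]
  nlinarith

end Duality

/-- The amount `β` by which the value of a form at unit vectors may fall short of the norm, for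
the vectors to be within `ε` of a subspace of the right dimension. The exponent accounts for the
losses in the argument: a square root and a division by `ε ^ 2` in passing from `x`, `y` to the
unit vectors along `x + y` and `x - y` (leaving `ε ^ 8`), a fourth root in passing to inner
products, and a square root in passing to distances. -/
noncomputable def extremalityGap (ε : ℝ) : ℝ := ε ^ 20 / 2 ^ 43

section Bilinear

variable {E : Type*} [NormedAddCommGroup E] [InnerProductSpace ℝ E] {B : E →L[ℝ] E →L[ℝ] ℝ}
  {x y : E}

theorem le_apply_normalize_add (hB : ‖B‖ ≤ 1) (hsymm : ∀ a b, B a b = B b a)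
    (hx : ‖x‖ = 1) (hy : ‖y‖ = 1) {ε : ℝ} (hε : 0 < ε) (hε1 : ε ≤ 1)
    (h : 1 - extremalityGap ε ≤ B x y) (hxy : ε ≤ ‖x + y‖) :
    1 - ε ^ 8 / 2 ^ 19 ≤ B (NormedSpace.normalize (x + y)) (NormedSpace.normalize (x + y)) := by
  have gap_eq : (ε ^ 10 / 2 ^ 21) ^ 2 / 2 = extremalityGap ε := by
    rw [extremalityGap]
    ring
  have hτ1 : ε ^ 10 / 2 ^ 21 ≤ 1 := by linarith [pow_le_one₀ (n := 10) hε.le hε1]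
  have hadd := norm_add_sq_sub_le_apply_add_add hB hsymm hx hy (by positivity) hτ1
    (by rwa [gap_eq])
  have hpos : 0 < ‖x + y‖ := hε.trans_le hxy
  have hsq : ε ^ 2 * (ε ^ 8 / 2 ^ 19) ≤ ‖x + y‖ ^ 2 * (ε ^ 8 / 2 ^ 19) := by gcongr
  simp only [NormedSpace.normalize, map_smul, smul_apply, smul_eq_mul]
  rw [← mul_assoc, ← mul_inv, ← sq, ← div_eq_inv_mul, le_div_iff₀ (by positivity)]
  nlinarith [show 0 ≤ ε ^ 10 by positivity]

theorem apply_normalize_sub_le (hB : ‖B‖ ≤ 1) (hsymm : ∀ a b, B a b = B b a)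
    (hx : ‖x‖ = 1) (hy : ‖y‖ = 1) {ε : ℝ} (hε : 0 < ε) (hε1 : ε ≤ 1)
    (h : 1 - extremalityGap ε ≤ B x y) (hxy : ε ≤ ‖x - y‖) :
    B (NormedSpace.normalize (x - y)) (NormedSpace.normalize (x - y))
      ≤ -(1 - ε ^ 8 / 2 ^ 19) := by
  have hneg := le_apply_normalize_add (B := -B) (x := x) (y := -y) (by rwa [norm_neg])
    (fun a b => congrArg Neg.neg (hsymm a b)) hx (by rwa [norm_neg]) hε hε1 (by simpa using h)
    (by rwa [← sub_eq_add_neg])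
  rw [← sub_eq_add_neg] at hneg
  exact le_neg_of_le_neg hneg

end Bilinear

/-- A symmetric real trilinear form of norm at most one. Freezing all but three arguments of a
symmetric multilinear form at unit vectors produces such a form. -/
structure IsSymmTrilinearContraction {E : Type*} [SeminormedAddCommGroup E] [NormedSpace ℝ E]
    (F : E →L[ℝ] E →L[ℝ] E →L[ℝ] ℝ) : Prop where
  swap_left : ∀ x y z, F x y z = F y x z
  swap_right : ∀ x y z, F x y z = F x z y
  norm_le_one : ‖F‖ ≤ 1

namespace IsSymmTrilinearContraction

section NormedSpace

variable {E : Type*} [SeminormedAddCommGroup E] [NormedSpace ℝ E]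
  {F : E →L[ℝ] E →L[ℝ] E →L[ℝ] ℝ}

theorem neg (hF : IsSymmTrilinearContraction F) : IsSymmTrilinearContraction (-F) where
  swap_left x y z := congrArg Neg.neg (hF.swap_left x y z)
  swap_right x y z := congrArg Neg.neg (hF.swap_right x y z)
  norm_le_one := (norm_neg F).trans_le hF.norm_le_one

theorem norm_apply_le_one (hF : IsSymmTrilinearContraction F) {x : E} (hx : ‖x‖ = 1) :
    ‖F x‖ ≤ 1 :=
  (F.unit_le_opNorm x hx.le).trans hF.norm_le_one

theorem norm_apply_apply_le (hF : IsSymmTrilinearContraction F) (x y : E) :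
    ‖F x y‖ ≤ ‖x‖ * ‖y‖ := by
  simpa using F.le_of_opNorm₂_le_of_le hF.norm_le_one le_rfl le_rfl

end NormedSpace

section InnerProductSpace

variable {E : Type*} [SeminormedAddCommGroup E] [InnerProductSpace ℝ E]
  {F : E →L[ℝ] E →L[ℝ] E →L[ℝ] ℝ}

theorem abs_apply_sub_inner_le (hF : IsSymmTrilinearContraction F) {x y u : E} (hx : ‖x‖ = 1)
    (hy : ‖y‖ = 1) (hu : ‖u‖ = 1) {σ : ℝ} (hσ : 0 ≤ σ) (h : 1 - σ ^ 2 / 2 ≤ F x y u)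
    {w : E} (hw : ‖w‖ = 1) : |F x y w - ⟪u, w⟫_ℝ| ≤ σ := by
  have hxy : ‖F x y‖ ≤ 1 := by simpa [hx, hy] using hF.norm_apply_apply_le x y
  have hsq := sq_apply_sub_inner_le hxy hu w
  rw [hw] at hsq
  exact abs_le_of_sq_le_sq (by linarith) hσ

theorem apply_self_le_of_apply_almost_one (hF : IsSymmTrilinearContraction F) {u z : E}
    (hu : ‖u‖ = 1) (hz : ‖z‖ = 1) {r : ℝ} (hr : 0 ≤ r) (hr1 : r ≤ 1)
    (h : 1 - r ^ 4 / 2 ^ 7 ≤ F z u u) : F z z z ≤ 2 * ⟪u, z⟫_ℝ ^ 2 - 1 + 2 * r := by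
  set c := ⟪u, z⟫_ℝ with hc
  have hσ : (r ^ 2 / 8) ^ 2 / 2 = r ^ 4 / 2 ^ 7 := by ring
  have huuz : F u u z = F z u u := by rw [hF.swap_right, hF.swap_left]
  have huzz : F u z z = F z u z := hF.swap_left u z z
  have huuu : |F u u u - c| ≤ r ^ 2 / 8 := by
    rw [hc, real_inner_comm]
    exact hF.abs_apply_sub_inner_le hu hu hz (by positivity) (by rwa [hσ, huuz]) hu
  have hzuz : |F z u z - c| ≤ r ^ 2 / 8 :=
    hF.abs_apply_sub_inner_le hz hu hu (by positivity) (by rwa [hσ]) hz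
  have norm_sq : ‖u + z‖ ^ 2 = 2 + 2 * c := by rw [norm_add_sq_real, hu, hz]; ring
  have expand (w : E) : F (u + z) (u + z) w = F u u w + 2 * F u z w + F z z w := by
    simp only [map_add, add_apply, hF.swap_left z u]
    ring
  have hcubic := sq_apply_sub_inner_le (hF.norm_apply_apply_le (u + z) (u + z)) hu z
  rw [← sq, norm_sq, expand, expand, hz, ← hc] at hcubic
  have huzu : F u z u = F z u u := hF.swap_left u z u
  have hzzu : F z z u = F z u z := hF.swap_right z z u
  rw [huuz, huzz, huzu, hzzu] at hcubic
  rw [abs_le] at huuu hzuz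
  have hc1 : |c| ≤ 1 := by simpa [hu, hz] using abs_real_inner_le_norm u z
  rw [abs_le] at hc1
  have hr4 : r ^ 4 ≤ r ^ 2 := pow_le_pow_of_le_one hr hr1 (by norm_num)
  have hr2 : r ^ 2 ≤ r := by nlinarith
  have defect_le : 2 + 2 * c - (F u u u + 2 * F z u u + F z u z) ≤ 9 / 32 * r ^ 2 := by linarith
  have cubic_le : F z u u + 2 * F z u z + F z z z - (2 + 2 * c) * c ≤ 3 / 2 * r := by
    refine (abs_le.mp (abs_le_of_sq_le_sq (hcubic.trans ?_) (by positivity))).2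
    have := mul_le_mul_of_nonneg_left defect_le (show 0 ≤ 2 * (2 + 2 * c) by linarith)
    nlinarith
  linarith

theorem one_sub_le_inner_sq_add_inner_sq (hF : IsSymmTrilinearContraction F) {u v z : E}
    (hu : ‖u‖ = 1) (hv : ‖v‖ = 1) (hz : ‖z‖ = 1) {ε : ℝ} (hε : ε ^ 2 ≤ 8)
    (hzuu : 1 - ε ^ 8 / 2 ^ 19 ≤ F z u u) (hzvv : F z v v ≤ -(1 - ε ^ 8 / 2 ^ 19)) :
    1 - (ε / 2) ^ 2 ≤ ⟪u, z⟫_ℝ ^ 2 + ⟪v, z⟫_ℝ ^ 2 := by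
  have hr : (ε ^ 2 / 8) ^ 4 / 2 ^ 7 = ε ^ 8 / 2 ^ 19 := by ring
  have hr1 : ε ^ 2 / 8 ≤ 1 := by linarith
  have le_inner_u := hF.apply_self_le_of_apply_almost_one hu hz (by positivity) hr1 (by rwa [hr])
  have le_inner_v := hF.neg.apply_self_le_of_apply_almost_one hv hz (by positivity) hr1
    (by rw [hr]; exact le_neg_of_le_neg hzvv)
  simp only [neg_apply] at le_inner_v
  linarith

end InnerProductSpace

theorem infDist_span_pair_le {E : Type*} [NormedAddCommGroup E] [InnerProductSpace ℝ E]
    {F : E →L[ℝ] E →L[ℝ] E →L[ℝ] ℝ} (hF : IsSymmTrilinearContraction F) {x y z : E}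
    (hx : ‖x‖ = 1) (hy : ‖y‖ = 1) (hz : ‖z‖ = 1) {ε : ℝ} (hε : 0 < ε) (hε1 : ε ≤ 1)
    (hadd : ε ≤ ‖x + y‖) (hsub : ε ≤ ‖x - y‖) (h : 1 - extremalityGap ε ≤ F z x y) :
    Metric.infDist z (Submodule.span ℝ {x, y} : Set E) ≤ ε := by
  set u := NormedSpace.normalize (x + y) with hu
  set v := NormedSpace.normalize (x - y) with hv
  have norm_u : ‖u‖ = 1 := NormedSpace.norm_normalize (norm_pos_iff.mp (hε.trans_le hadd))
  have norm_v : ‖v‖ = 1 := NormedSpace.norm_normalize (norm_pos_iff.mp (hε.trans_le hsub))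
  have hzuu : 1 - ε ^ 8 / 2 ^ 19 ≤ F z u u :=
    le_apply_normalize_add (hF.norm_apply_le_one hz) (hF.swap_right z) hx hy hε hε1 h hadd
  have hzvv : F z v v ≤ -(1 - ε ^ 8 / 2 ^ 19) :=
    apply_normalize_sub_le (hF.norm_apply_le_one hz) (hF.swap_right z) hx hy hε hε1 h hsub
  have inner_uv : ⟪u, v⟫_ℝ = 0 := by
    simp only [hu, hv, NormedSpace.normalize, inner_smul_left, inner_smul_right]
    simp [(real_inner_add_sub_eq_zero_iff x y).mpr (hx.trans hy.symm)]
  have span_le : Submodule.span ℝ (Set.range ![u, v]) ≤ Submodule.span ℝ {x, y} := by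
    have hxV : x ∈ Submodule.span ℝ {x, y} := Submodule.subset_span (by simp)
    have hyV : y ∈ Submodule.span ℝ {x, y} := Submodule.subset_span (by simp)
    rw [Submodule.span_le, Set.range_subset_iff, Fin.forall_fin_two]
    exact ⟨Submodule.smul_mem _ _ (add_mem hxV hyV), Submodule.smul_mem _ _ (sub_mem hxV hyV)⟩
  have orthonormal_uv : Orthonormal ℝ ![u, v] := by simp [norm_u, norm_v, inner_uv]
  have infDist_sq := sq_infDist_span_range_le_of_orthonormal orthonormal_uv z
  have inner_sq := hF.one_sub_le_inner_sq_add_inner_sq norm_u norm_v hz (by nlinarith) hzuu hzvv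
  simp only [Fin.sum_univ_two, Matrix.cons_val_zero, Matrix.cons_val_one, Real.norm_eq_abs, sq_abs,
    hz] at infDist_sq
  calc
    _ ≤ Metric.infDist z (Submodule.span ℝ (Set.range ![u, v]) : Set E) :=
      Metric.infDist_le_infDist_of_subset span_le ⟨0, zero_mem _⟩
    _ ≤ ε / 2 := abs_le_of_sq_le_sq' (by linarith) (by positivity) |>.2
    _ ≤ ε := by linarith

end IsSymmTrilinearContraction

section Complex

variable {H : Type*} [NormedAddCommGroup H] [InnerProductSpace ℂ H]
  {F : H →L[ℝ] H →L[ℝ] H →L[ℝ] ℝ}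

namespace IsSymmTrilinearContraction

theorem infDist_complex_span_singleton_le (hF : IsSymmTrilinearContraction F)
    {u z : H} (hI : F z (Complex.I • u) (Complex.I • u) = -F z u u)
    (hu : ‖u‖ = 1) (hz : ‖z‖ = 1) {ε : ℝ} (hε : 0 ≤ ε) (hε8 : ε ^ 2 ≤ 8)
    (h : 1 - ε ^ 8 / 2 ^ 19 ≤ F z u u) :
    Metric.infDist u (Submodule.span ℂ {z} : Set H) ≤ ε / 2 := by
  let _ : InnerProductSpace ℝ H := InnerProductSpace.complexToReal
  have norm_Iu : ‖Complex.I • u‖ = 1 := by rw [norm_smul, Complex.norm_I, one_mul, hu]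
  have inner_sq := hF.one_sub_le_inner_sq_add_inner_sq hu norm_Iu hz hε8 h
    (by rw [hI]; exact neg_le_neg h)
  have norm_inner_sq : ⟪u, z⟫_ℝ ^ 2 + ⟪Complex.I • u, z⟫_ℝ ^ 2 = ‖⟪z, u⟫_ℂ‖ ^ 2 := by
    rw [real_inner_eq_re_inner ℂ, real_inner_eq_re_inner ℂ, inner_smul_left, norm_inner_symm,
      ← Complex.normSq_eq_norm_sq, Complex.normSq_apply]
    simp only [RCLike.re_to_complex, Complex.conj_I, neg_mul, Complex.neg_re, Complex.mul_re,
      Complex.I_re, zero_mul, Complex.I_im, one_mul, zero_sub, neg_neg]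
    ring
  have orthonormal_z : Orthonormal ℂ (fun _ : Unit => z) :=
    ⟨fun _ => hz, Subsingleton.pairwise⟩
  have infDist_sq := sq_infDist_span_range_le_of_orthonormal orthonormal_z u
  rw [Set.range_const, Fintype.sum_unique, hu] at infDist_sq
  exact (abs_le_of_sq_le_sq' (by linarith) (by positivity)).2

theorem infDist_add_complex_span_singleton_le (hF : IsSymmTrilinearContraction F)
    (hI : ∀ a c, F c (Complex.I • a) (Complex.I • a) = -F c a a) {x y z : H}
    (hx : ‖x‖ = 1) (hy : ‖y‖ = 1) (hz : ‖z‖ = 1) {ε : ℝ} (hε : 0 < ε) (hε1 : ε ≤ 1)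
    (h : 1 - extremalityGap ε ≤ F z x y) :
    Metric.infDist (x + y) (Submodule.span ℂ {z} : Set H) ≤ ε := by
  let _ : InnerProductSpace ℝ H := InnerProductSpace.complexToReal
  rcases le_total ‖x + y‖ ε with hxy | hxy
  · exact (Metric.infDist_le_dist_of_mem (zero_mem _)).trans (by rwa [dist_zero_right])
  have norm_u : ‖NormedSpace.normalize (x + y)‖ = 1 :=
    NormedSpace.norm_normalize (norm_pos_iff.mp (hε.trans_le hxy))
  have hzuu :=
    le_apply_normalize_add (hF.norm_apply_le_one hz) (hF.swap_right z) hx hy hε hε1 h hxy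
  have infDist_le := hF.infDist_complex_span_singleton_le (hI _ z) norm_u hz hε.le
    (by nlinarith) hzuu
  have norm_add_le_two : ‖x + y‖ ≤ 2 := (norm_add_le x y).trans (by rw [hx, hy]; norm_num)
  calc
    _ = ‖x + y‖ * Metric.infDist (NormedSpace.normalize (x + y))
        (Submodule.span ℂ {z} : Set H) := by
      conv_lhs => rw [← NormedSpace.norm_smul_normalize (x + y), ← Complex.coe_smul,
        infDist_submodule_smul, Complex.norm_real, norm_norm]
    _ ≤ 2 * (ε / 2) := by gcongr; exact Metric.infDist_nonneg
    _ = ε := by ring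

theorem infDist_complex_span_singleton_le_of_almost_extremal (hF : IsSymmTrilinearContraction F)
    (hI : ∀ a c, F c (Complex.I • a) (Complex.I • a) = -F c a a) {x y z : H}
    (hx : ‖x‖ = 1) (hy : ‖y‖ = 1) (hz : ‖z‖ = 1) {ε : ℝ} (hε : 0 < ε) (hε1 : ε ≤ 1)
    (h : 1 - extremalityGap ε ≤ F z x y) :
    Metric.infDist x (Submodule.span ℂ {z} : Set H) ≤ ε := by
  have infDist_add := hF.infDist_add_complex_span_singleton_le hI hx hy hz hε hε1 h
  have infDist_sub := hF.neg.infDist_add_complex_span_singleton_le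
    (fun a c => congrArg Neg.neg (hI a c)) hx (y := -y) (by rwa [norm_neg]) hz hε hε1
    (by simpa using h)
  have midpoint : x = (1 / 2 : ℂ) • ((x + y) + (x + -y)) := by module
  have infDist_le := infDist_submodule_add_le (Submodule.span ℂ {z}) (x + y) (x + -y)
  rw [midpoint, infDist_submodule_smul, norm_div, norm_one, Complex.norm_two]
  linarith

end IsSymmTrilinearContraction

end Complex

section Multilinear

theorem IsSymmForm.apply_update_update_comm {𝕜 H : Type*} [RCLike 𝕜] [NormedAddCommGroup H]
    [InnerProductSpace 𝕜 H] {k : ℕ} {T : ContinuousMultilinearMap 𝕜 (fun _ : Fin k => H) 𝕜}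
    (hT : IsSymmForm T) {i j : Fin k} (hij : i ≠ j) (w : Fin k → H) (a b : H) :
    T (update (update w i a) j b) = T (update (update w i b) j a) := by
  rw [← hT (Equiv.swap i j)]
  congr 1
  ext m
  simp only [update_apply, Equiv.swap_apply_def]
  grind

theorem prod_norm_update_of_norm_eq_one {ι E : Type*} [Fintype ι] [DecidableEq ι]
    [SeminormedAddCommGroup E] {w : ι → E} {i : ι} (hi : ‖w i‖ = 1) (a : E) :
    ∏ m, ‖update w i a m‖ = ‖a‖ * ∏ m, ‖w m‖ := by
  rw [← Finset.mul_prod_erase _ _ (Finset.mem_univ i),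
    ← Finset.mul_prod_erase _ (fun m => ‖w m‖) (Finset.mem_univ i), hi, one_mul, update_self]
  congr 1
  exact Finset.prod_congr rfl fun m hm => by rw [update_of_ne (Finset.ne_of_mem_erase hm)]

section Freeze

variable {𝕜 ι E G : Type*} [NontriviallyNormedField 𝕜] [Fintype ι] [DecidableEq ι]
  [SeminormedAddCommGroup E] [NormedSpace 𝕜 E] [SeminormedAddCommGroup G] [NormedSpace 𝕜 G]

theorem norm_apply_update_three_le (T : ContinuousMultilinearMap 𝕜 (fun _ : ι => E) G) {x : ι → E}
    (hx : ∀ m, ‖x m‖ = 1) {i j l : ι} (hij : i ≠ j) (hil : i ≠ l) (hjl : j ≠ l) (a b c : E) :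
    ‖T (update (update (update x i a) j b) l c)‖ ≤ ‖T‖ * ‖a‖ * ‖b‖ * ‖c‖ := by
  have norm_j : ‖update x i a j‖ = 1 := by rw [update_of_ne hij.symm, hx]
  have norm_l : ‖update (update x i a) j b l‖ = 1 := by
    rw [update_of_ne hjl.symm, update_of_ne hil.symm, hx]
  refine (T.le_opNorm _).trans_eq ?_
  rw [prod_norm_update_of_norm_eq_one norm_l, prod_norm_update_of_norm_eq_one norm_j,
    prod_norm_update_of_norm_eq_one (hx i), Finset.prod_eq_one fun m _ => hx m]
  ring

/-- The trilinear map obtained from `T` by freezing all arguments other than `i`, `j`, `l` at the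
unit vectors `x m`. -/
noncomputable def freezeAllButThree (T : ContinuousMultilinearMap 𝕜 (fun _ : ι => E) G) {x : ι → E}
    (hx : ∀ m, ‖x m‖ = 1) {i j l : ι} (hij : i ≠ j) (hil : i ≠ l) (hjl : j ≠ l) :
    E →L[𝕜] E →L[𝕜] E →L[𝕜] G :=
  LinearMap.mkContinuous₂
    (LinearMap.mk₂ 𝕜 (fun a b => T.toContinuousLinearMap (update (update x i a) j b) l)
      (fun a a' b => by ext c; simp [update_comm hij, update_comm hil])
      (fun r a b => by ext c; simp [update_comm hij, update_comm hil])
      (fun a b b' => by ext c; simp [update_comm hjl])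
      (fun r a b => by ext c; simp [update_comm hjl]))
    ‖T‖ fun a b => ContinuousLinearMap.opNorm_le_bound _ (by positivity) fun c =>
      norm_apply_update_three_le T hx hij hil hjl a b c

@[simp]
theorem freezeAllButThree_apply (T : ContinuousMultilinearMap 𝕜 (fun _ : ι => E) G) {x : ι → E}
    (hx : ∀ m, ‖x m‖ = 1) {i j l : ι} (hij : i ≠ j) (hil : i ≠ l) (hjl : j ≠ l) (a b c : E) :
    freezeAllButThree T hx hij hil hjl a b c = T (update (update (update x i a) j b) l c) := rfl

theorem norm_freezeAllButThree_le (T : ContinuousMultilinearMap 𝕜 (fun _ : ι => E) G) {x : ι → E}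
    (hx : ∀ m, ‖x m‖ = 1) {i j l : ι} (hij : i ≠ j) (hil : i ≠ l) (hjl : j ≠ l) :
    ‖freezeAllButThree T hx hij hil hjl‖ ≤ ‖T‖ :=
  LinearMap.mkContinuous₂_norm_le _ (norm_nonneg T) _

end Freeze

theorem IsSymmForm.isSymmTrilinearContraction_freezeAllButThree {H : Type*} [NormedAddCommGroup H]
    [InnerProductSpace ℝ H] {k : ℕ} {T : ContinuousMultilinearMap ℝ (fun _ : Fin k => H) ℝ}
    (hT : IsSymmForm T) (hnorm : ‖T‖ ≤ 1) {x : Fin k → H} (hx : ∀ m, ‖x m‖ = 1)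
    {i j l : Fin k} (hij : i ≠ j) (hil : i ≠ l) (hjl : j ≠ l) :
    IsSymmTrilinearContraction (freezeAllButThree T hx hij hil hjl) where
  swap_left a b c := by
    simp only [freezeAllButThree_apply]
    rw [update_comm hjl, update_comm hil, hT.apply_update_update_comm hij,
      update_comm hil.symm, update_comm hjl.symm]
  swap_right a b c := by
    simp only [freezeAllButThree_apply]
    exact hT.apply_update_update_comm hjl _ b c
  norm_le_one := (norm_freezeAllButThree_le T hx hij hil hjl).trans hnorm

section RotatedRe

variable {𝕜 ι H : Type*} [RCLike 𝕜]

/-- The real part of the form `ω T`. For a suitable unimodular `ω` its value at a given point is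
the absolute value of that of `T`. -/
noncomputable def rotatedRe [SeminormedAddCommGroup H] [NormedSpace ℝ H] [NormedSpace 𝕜 H]
    [IsScalarTower ℝ 𝕜 H] (ω : 𝕜) (T : ContinuousMultilinearMap 𝕜 (fun _ : ι => H) 𝕜) :
    ContinuousMultilinearMap ℝ (fun _ : ι => H) ℝ :=
  RCLike.reCLM.compContinuousMultilinearMap ((ω • T).restrictScalars ℝ)

section Seminormed

variable [SeminormedAddCommGroup H] [NormedSpace ℝ H] [NormedSpace 𝕜 H] [IsScalarTower ℝ 𝕜 H]

@[simp]
theorem rotatedRe_apply (ω : 𝕜) (T : ContinuousMultilinearMap 𝕜 (fun _ : ι => H) 𝕜) (w : ι → H) :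
    rotatedRe ω T w = RCLike.re (ω * T w) := rfl

theorem norm_rotatedRe_le [Fintype ι] (ω : 𝕜)
    (T : ContinuousMultilinearMap 𝕜 (fun _ : ι => H) 𝕜) :
    ‖rotatedRe ω T‖ ≤ ‖ω‖ * ‖T‖ := by
  refine ContinuousMultilinearMap.opNorm_le_bound (by positivity) fun w => ?_
  rw [← norm_smul]
  exact (RCLike.norm_re_le_norm _).trans ((ω • T).le_opNorm w)

theorem exists_norm_rotatedRe_le_and_rotatedRe_apply_eq [Fintype ι]
    (T : ContinuousMultilinearMap 𝕜 (fun _ : ι => H) 𝕜) (w : ι → H) :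
    ∃ ω : 𝕜, ‖rotatedRe ω T‖ ≤ ‖T‖ ∧ rotatedRe ω T w = ‖T w‖ := by
  obtain ⟨ω, norm_ω, hω⟩ := RCLike.exists_norm_eq_mul_self (T w)
  refine ⟨ω, by simpa [norm_ω] using norm_rotatedRe_le ω T, ?_⟩
  rw [rotatedRe_apply, ← hω, RCLike.ofReal_re]

end Seminormed

theorem IsSymmForm.rotatedRe [NormedAddCommGroup H] [InnerProductSpace ℝ H]
    [InnerProductSpace 𝕜 H] [IsScalarTower ℝ 𝕜 H] {k : ℕ}
    {T : ContinuousMultilinearMap 𝕜 (fun _ : Fin k => H) 𝕜} (hT : IsSymmForm T) (ω : 𝕜) :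
    IsSymmForm (rotatedRe ω T) := fun σ w => by
  rw [rotatedRe_apply, hT σ w, rotatedRe_apply]

theorem freezeAllButThree_rotatedRe_I_smul [Fintype ι] [DecidableEq ι]
    [SeminormedAddCommGroup H] [NormedSpace ℝ H] [NormedSpace ℂ H] [IsScalarTower ℝ ℂ H] (ω : ℂ)
    (T : ContinuousMultilinearMap ℂ (fun _ : ι => H) ℂ) {x : ι → H} (hx : ∀ m, ‖x m‖ = 1)
    {i j l : ι} (hij : i ≠ j) (hil : i ≠ l) (hjl : j ≠ l) (a c : H) :
    freezeAllButThree (rotatedRe ω T) hx hij hil hjl c (Complex.I • a) (Complex.I • a)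
      = -freezeAllButThree (rotatedRe ω T) hx hij hil hjl c a a := by
  simp only [freezeAllButThree_apply, rotatedRe_apply]
  rw [T.map_update_smul, update_comm hjl, T.map_update_smul, update_comm hjl.symm, smul_smul,
    Complex.I_mul_I, neg_one_smul, mul_neg, map_neg]

end RotatedRe

end Multilinear

section AlmostExtremal

theorem infDist_le_of_mem {E : Type*} [SeminormedAddCommGroup E] {s : Set E} {x v : E} {ε : ℝ}
    (hv : v ∈ s) (h : ‖x - v‖ ≤ ε) : Metric.infDist x s ≤ ε :=
  (Metric.infDist_le_dist_of_mem hv).trans (by rwa [dist_eq_norm])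

variable {H : Type*} [NormedAddCommGroup H] {k : ℕ} {x : Fin k → H} {ε : ℝ}

theorem IsSymmForm.infDist_real_span_pair_le [InnerProductSpace ℝ H]
    {T : ContinuousMultilinearMap ℝ (fun _ : Fin k => H) ℝ} (hT : IsSymmForm T) (hnorm : ‖T‖ ≤ 1)
    (hx : ∀ m, ‖x m‖ = 1) (hε : 0 < ε) (hε1 : ε ≤ 1) (h : 1 - extremalityGap ε ≤ ‖T x‖)
    {i j : Fin k} (hadd : ε ≤ ‖x i + x j‖) (hsub : ε ≤ ‖x i - x j‖) (l : Fin k) :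
    Metric.infDist (x l) (Submodule.span ℝ {x i, x j} : Set H) ≤ ε := by
  have hij : i ≠ j := by
    rintro rfl
    rw [sub_self, norm_zero] at hsub
    exact hε.not_ge hsub
  rcases eq_or_ne l i with rfl | hli
  · exact infDist_le_of_mem (Submodule.subset_span (by simp)) (v := x l) (by simpa using hε.le)
  rcases eq_or_ne l j with rfl | hlj
  · exact infDist_le_of_mem (Submodule.subset_span (by simp)) (v := x l) (by simpa using hε.le)
  obtain ⟨ω, norm_le, apply_eq⟩ := exists_norm_rotatedRe_le_and_rotatedRe_apply_eq T x
  have hF := (hT.rotatedRe ω).isSymmTrilinearContraction_freezeAllButThree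
    (norm_le.trans hnorm) hx hli hlj hij
  refine hF.infDist_span_pair_le (hx i) (hx j) (hx l) hε hε1 hadd hsub ?_
  rwa [freezeAllButThree_apply, update_eq_self, update_eq_self, update_eq_self, apply_eq]

theorem IsSymmForm.exists_real_submodule_infDist_le [InnerProductSpace ℝ H] [NeZero k]
    {T : ContinuousMultilinearMap ℝ (fun _ : Fin k => H) ℝ} (hT : IsSymmForm T) (hnorm : ‖T‖ ≤ 1)
    (hx : ∀ m, ‖x m‖ = 1) (hε : 0 < ε) (hε1 : ε ≤ 1) (h : 1 - extremalityGap ε ≤ ‖T x‖) :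
    ∃ V ≤ Submodule.span ℝ (Set.range x),
      Module.finrank ℝ V ≤ 2 ∧ ∀ j, Metric.infDist (x j) (V : Set H) ≤ ε := by
  by_cases nearly_parallel : ∀ j, ‖x 0 + x j‖ ≤ ε ∨ ‖x 0 - x j‖ ≤ ε
  · refine ⟨Submodule.span ℝ {x 0}, Submodule.span_mono (by simp),
      (finrank_span_le_card {x 0}).trans (by simp), fun j => ?_⟩
    have mem_span := Submodule.mem_span_singleton_self (R := ℝ) (x 0)
    rcases nearly_parallel j with hadd | hsub
    · exact infDist_le_of_mem (neg_mem mem_span) (by rwa [sub_neg_eq_add, add_comm])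
    · exact infDist_le_of_mem mem_span (by rwa [norm_sub_rev])
  · push Not at nearly_parallel
    obtain ⟨j, hadd, hsub⟩ := nearly_parallel
    refine ⟨Submodule.span ℝ {x 0, x j}, Submodule.span_mono (by simp [Set.pair_subset_iff]), ?_,
      hT.infDist_real_span_pair_le hnorm hx hε hε1 h hadd.le hsub.le⟩
    classical
    have finrank_le := finrank_span_finset_le_card (R := ℝ) {x 0, x j}
    rw [Finset.coe_pair] at finrank_le
    exact finrank_le.trans Finset.card_le_two

theorem IsSymmForm.infDist_complex_span_singleton_le [InnerProductSpace ℂ H] (hk : 3 ≤ k)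
    {T : ContinuousMultilinearMap ℂ (fun _ : Fin k => H) ℂ} (hT : IsSymmForm T) (hnorm : ‖T‖ ≤ 1)
    (hx : ∀ m, ‖x m‖ = 1) (hε : 0 < ε) (hε1 : ε ≤ 1) (h : 1 - extremalityGap ε ≤ ‖T x‖)
    (i l : Fin k) : Metric.infDist (x i) (Submodule.span ℂ {x l} : Set H) ≤ ε := by
  let _ : InnerProductSpace ℝ H := InnerProductSpace.complexToReal
  rcases eq_or_ne l i with rfl | hli
  · exact infDist_le_of_mem (Submodule.mem_span_singleton_self (x l)) (by simpa using hε.le)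
  obtain ⟨j, hjl, hji⟩ : ∃ j, j ≠ l ∧ j ≠ i := Fin.exists_ne_and_ne_of_two_lt l i hk
  obtain ⟨ω, norm_le, apply_eq⟩ := exists_norm_rotatedRe_le_and_rotatedRe_apply_eq T x
  have hF := (hT.rotatedRe ω).isSymmTrilinearContraction_freezeAllButThree
    (norm_le.trans hnorm) hx hli hjl.symm hji.symm
  refine hF.infDist_complex_span_singleton_le_of_almost_extremal
    (freezeAllButThree_rotatedRe_I_smul ω T hx hli hjl.symm hji.symm) (hx i) (hx j) (hx l)
    hε hε1 ?_
  rwa [freezeAllButThree_apply, update_eq_self, update_eq_self, update_eq_self, apply_eq]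

theorem IsSymmForm.exists_complex_submodule_infDist_le [InnerProductSpace ℂ H] (hk : 3 ≤ k)
    {T : ContinuousMultilinearMap ℂ (fun _ : Fin k => H) ℂ} (hT : IsSymmForm T) (hnorm : ‖T‖ ≤ 1)
    (hx : ∀ m, ‖x m‖ = 1) (hε : 0 < ε) (hε1 : ε ≤ 1) (h : 1 - extremalityGap ε ≤ ‖T x‖) :
    ∃ V ≤ Submodule.span ℂ (Set.range x),
      Module.finrank ℂ V = 1 ∧ ∀ j, Metric.infDist (x j) (V : Set H) ≤ ε := by
  let l : Fin k := ⟨0, by lia⟩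
  exact ⟨Submodule.span ℂ {x l}, Submodule.span_mono (by simp),
    finrank_span_singleton (norm_ne_zero_iff.mp (by simp [hx])),
    fun i => hT.infDist_complex_span_singleton_le hk hnorm hx hε hε1 h i l⟩

end AlmostExtremal

theorem mainTheorem4_general {ε : ℝ} (hε : 0 < ε) :
    ∃ β : ℝ, 0 < β ∧ ∀ k : ℕ, 3 ≤ k →
      (∀ (H : Type u) [NormedAddCommGroup H] [InnerProductSpace ℝ H]
        (T : ContinuousMultilinearMap ℝ (fun _ : Fin k => H) ℝ) (x : Fin k → H),
        IsSymmForm T → ‖T‖ ≤ 1 → (∀ j, ‖x j‖ = 1) → 1 - β < ‖T x‖ →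
          ∃ V : Submodule ℝ H, V ≤ Submodule.span ℝ (Set.range x) ∧
            Module.finrank ℝ V ≤ 2 ∧ ∀ j, Metric.infDist (x j) (V : Set H) ≤ ε) ∧
      (∀ (H : Type u) [NormedAddCommGroup H] [InnerProductSpace ℂ H]
        (T : ContinuousMultilinearMap ℂ (fun _ : Fin k => H) ℂ) (x : Fin k → H),
        IsSymmForm T → ‖T‖ ≤ 1 → (∀ j, ‖x j‖ = 1) → 1 - β < ‖T x‖ →
          ∃ V : Submodule ℂ H, V ≤ Submodule.span ℂ (Set.range x) ∧
            Module.finrank ℂ V = 1 ∧ ∀ j, Metric.infDist (x j) (V : Set H) ≤ ε) := by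
  set δ := min ε 1
  have hδ : 0 < δ := lt_min hε one_pos
  have hδ1 : δ ≤ 1 := min_le_right _ _
  have hδε : δ ≤ ε := min_le_left _ _
  refine ⟨extremalityGap δ, by unfold extremalityGap; positivity, fun k hk => ⟨?_, ?_⟩⟩
  · intro H _ _ T x hT hnorm hx h
    have : NeZero k := ⟨by lia⟩
    obtain ⟨V, V_le, finrank_V, infDist_V⟩ :=
      hT.exists_real_submodule_infDist_le hnorm hx hδ hδ1 h.le
    exact ⟨V, V_le, finrank_V, fun j => (infDist_V j).trans hδε⟩
  · intro H _ _ T x hT hnorm hx h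
    obtain ⟨V, V_le, finrank_V, infDist_V⟩ :=
      hT.exists_complex_submodule_infDist_le hk hnorm hx hδ hδ1 h.le
    exact ⟨V, V_le, finrank_V, fun j => (infDist_V j).trans hδε⟩

theorem mainTheorem4 (k : ℕ) (hk : 3 ≤ k) (ε : ℝ) (hε : 0 < ε) :
    ∃ β : ℝ, 0 < β ∧
      (∀ (H : Type u) [NormedAddCommGroup H] [InnerProductSpace ℝ H] [CompleteSpace H]
        (T : ContinuousMultilinearMap ℝ (fun _ : Fin k => H) ℝ) (x : Fin k → H),
        IsSymmForm T → ‖T‖ = 1 → (∀ j, ‖x j‖ = 1) → 1 - β < ‖T x‖ →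
          ∃ V : Submodule ℝ H, V ≤ Submodule.span ℝ (Set.range x) ∧
            Module.finrank ℝ V ≤ 2 ∧ ∀ j, Metric.infDist (x j) (V : Set H) ≤ ε) ∧
      (∀ (H : Type u) [NormedAddCommGroup H] [InnerProductSpace ℂ H] [CompleteSpace H]
        (T : ContinuousMultilinearMap ℂ (fun _ : Fin k => H) ℂ) (x : Fin k → H),
        IsSymmForm T → ‖T‖ = 1 → (∀ j, ‖x j‖ = 1) → 1 - β < ‖T x‖ →
          ∃ V : Submodule ℂ H, V ≤ Submodule.span ℂ (Set.range x) ∧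
            Module.finrank ℂ V = 1 ∧ ∀ j, Metric.infDist (x j) (V : Set H) ≤ ε) := by
  obtain ⟨β, hβ, h⟩ := mainTheorem4_general hε
  exact ⟨β, hβ, fun H _ _ _ T x hT hnorm => (h k hk).1 H T x hT hnorm.le,
    fun H _ _ _ T x hT hnorm => (h k hk).2 H T x hT hnorm.le⟩
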